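/- **Conventions.** A stable graph $\Gamma$ of genus $g$ is a finite connected graph (loops and multiple edges allowed) with a genus $g(v)\ge 0$ at each vertex and finitely many legs, such that $2g(v)-2+n(v)>0$ at each vertex ($n(v)$ counts the half-edges and legs at $v$) and $\sum_v g(v)+|E(\Gamma)|-|V(\Gamma)|+1=g$. It is of type $(g,n)$ if its legs are numbered by $\{1,\dots,n\}$; isomorphisms of such graphs preserve the numbering. For a connected subgraph $\Gamma_0\subseteq\Gamma$ containing all vertices let $e_{\Gamma,\Gamma_0}=|E(\Gamma)\setminus E(\Gamma_0)|$ and $\mathrm{Pic}(\Gamma_0)=\mathbb Z^{V(\Gamma)}/\mathrm{Twist}_{\Gamma_0}$, where $\mathrm{Twist}_{\Gamma_0}$ is generated, for all vertices $v$, by the multidegrees $\sum_{h}([w_h]-[v])$, with $h$ running over the half-edges of $\Gamma_0$ at $v$ and $w_h$ the other endpoint of the edge of $h$; $\mathrm{Pic}^k(\Gamma_0)$ is the part of total degree $k$. A *Pagani–Tommasi stability condition* $\sigma$ of degree $d\in\mathbb Z$ over $\overline{\mathcal M}_{g,n}$ is a collection of triples $(\Gamma,\Gamma_0,\underline d)$,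 with $\Gamma$ a stable graph of type $(g,n)$, $\Gamma_0\subseteq\Gamma$ a connected subgraph containing all vertices, and $\underline d:V(\Gamma)\to\mathbb Z$, such that: 1. for all $(\Gamma,\Gamma_0)$, the map $\{\underline d:(\Gamma,\Gamma_0,\underline d)\in\sigma\}\to\mathrm{Pic}^{d-e_{\Gamma,\Gamma_0}}(\Gamma_0)$ is a bijection; 2. for every isomorphism $f:\Gamma'\to\Gamma$ of stable graphs of type $(g,n)$, $(\Gamma,\Gamma_0,\underline d)\in\sigma$ if and only if $(\Gamma',f^{-1}\Gamma_0,\underline d\circ f)\in\sigma$; 3. if $(\Gamma,\Gamma_0,\underline d)\in\sigma$ and $e$ is an edge of $\Gamma$ not in $\Gamma_0$, then $(\Gamma,\Gamma_0\cup e,\underline d+[v])\in\sigma$ for each endpoint $v$ of $e$; 4. if $(\Gamma,\Gamma_0,\underline d)\in\sigma$ and $f:\Gamma\to\Gamma'$ is a contraction of stable graphs of type $(g,n)$, then $(\Gamma',f(\Gamma_0),\underline d')\in\sigma$, where $\underline d'(w)=\sum_{f(v)=w}\underline d(v)+\#\{\text{edges not in }\Gamma_0\text{ contracted to }w\}$.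 Let $\{1,\dots,n\}$ be partitioned into $p$ blocks of sizes $n_1,\dots,n_p\ge 0$, and let $S_\lambda=S_{n_1}\times\dots\times S_{n_p}\subseteq S_n$ be the subgroup preserving each block. $S_n$ acts on triples by renumbering legs. Let $\Gamma$ be a stable graph of genus $g$ with $n$ legs, of which exactly $n_k$ carry the label $k$, for $k=1,\dots,p$ (legs with equal labels are indistinguishable). If $\sigma$ is $S_\lambda$-invariant, $(\Gamma,\Gamma_0,\underline d)\in\sigma$ means that the triple lies in $\sigma$ after numbering the legs of $\Gamma$ so that the legs labeled $k$ get the numbers in the $k$-th block; this does not depend on the numbering. Let $\mathrm{Aut}(\Gamma,\Gamma_0)$ be the group of automorphisms of $\Gamma$ that preserve the labels of the legs and send $\Gamma_0$ to itself; $f\in \mathrm{Aut}(\Gamma,\Gamma_0)$ acts on multidegrees by $\underline d\mapsto\underline d\circ f$. **Lemma.** Let $\sigma$ and $\sigma'$ be Pagani–Tommasi stability conditions over $\overline{\mathcal M}_{g,n}$ of degrees $d$ and $d'$, both invariant under $S_\lambda$. Let $\Gamma$ be a stable graph of genus $g$ with $n_k$ legs labeled $k$ for $k=1,\dots,p$,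 and let $\Gamma_0\subseteq\Gamma$ be a connected subgraph containing all vertices. Then $\mathrm{Aut}(\Gamma,\Gamma_0)$ acts on the sets $$\{\underline d:(\Gamma,\Gamma_0,\underline d)\in\sigma\}\qquad\text{and}\qquad\{\underline d':(\Gamma,\Gamma_0,\underline d')\in\sigma'\},$$ and there exists an $\mathrm{Aut}(\Gamma,\Gamma_0)$-equivariant bijection between them. -/

import Mathlib

noncomputable section

/-- A finite vertex-weighted graph given by half-edges: `root` sends a half-edge to its vertex, and
`flip` is the fixed-point-free involution whose orbits are the edges.  Loops and multiple edges are
allowed. -/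
structure HalfEdgeGraph where
  V : Type
  H : Type
  [fintypeV : Fintype V]
  [fintypeH : Fintype H]
  root : H → V
  flip : H → H
  flip_flip : ∀ h, flip (flip h) = h
  flip_ne : ∀ h, flip h ≠ h
  genus : V → ℕ

attribute [instance] HalfEdgeGraph.fintypeV HalfEdgeGraph.fintypeH

namespace HalfEdgeGraph

variable (Γ : HalfEdgeGraph)

open scoped Classical in
/-- The number of edges, i.e. of unordered pairs `{h, flip h}`, met by the set `S` of
half-edges. -/
def edgeCount (S : Finset Γ.H) : ℕ := (S.image fun h => s(h, Γ.flip h)).card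

/-- `v` and `w` are joined by an edge in `S`. -/
def Step (S : Finset Γ.H) (v w : Γ.V) : Prop := ∃ h ∈ S, Γ.root h = v ∧ Γ.root (Γ.flip h) = w

/-- A connected subgraph containing all vertices, given by its (flip-closed) set of half-edges. -/
@[ext]
structure ConnectedSubgraph where
  halfEdges : Finset Γ.H
  flip_mem : ∀ h ∈ halfEdges, Γ.flip h ∈ halfEdges
  connected : ∀ v w, Relation.ReflTransGen (Γ.Step halfEdges) v w

/-- The total degree of a multidegree. -/
def degree : (Γ.V → ℤ) →+ ℤ where
  toFun D := ∑ v, D v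
  map_zero' := by simp
  map_add' := by intro D D'; simp [Finset.sum_add_distrib]

namespace ConnectedSubgraph

variable {Γ} (Γ₀ : Γ.ConnectedSubgraph)

open scoped Classical in
/-- `e_{Γ,Γ₀}`: the number of edges of `Γ` that are not in `Γ₀`. -/
def missingEdges : ℕ := Γ.edgeCount (Γ₀.halfEdgesᶜ)

open scoped Classical in
/-- The multidegree obtained by twisting by the vertex `v` of `Γ₀`: one unit is moved from `v`
along each half-edge of `Γ₀` at `v`. -/
def twistAt (v : Γ.V) : Γ.V → ℤ :=
  ∑ h ∈ Γ₀.halfEdges with Γ.root h = v, (Pi.single (Γ.root (Γ.flip h)) 1 - Pi.single v 1)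

/-- The group `Twist_{Γ₀}`. -/
def twist : AddSubgroup (Γ.V → ℤ) := AddSubgroup.closure (Set.range Γ₀.twistAt)

theorem degree_twist : Γ₀.twist ≤ (Γ.degree).ker := by
  classical
  refine (AddSubgroup.closure_le _).2 ?_
  rintro _ ⟨v, rfl⟩
  simp only [SetLike.mem_coe, AddMonoidHom.mem_ker, twistAt, map_sum, map_sub]
  refine Finset.sum_eq_zero fun h _ => ?_
  simp [degree]

/-- The Picard group of `Γ₀`. -/
abbrev Pic : Type := (Γ.V → ℤ) ⧸ Γ₀.twist

/-- The total degree on the Picard group. -/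
def picDegree : Γ₀.Pic →+ ℤ :=
  QuotientAddGroup.lift Γ₀.twist Γ.degree Γ₀.degree_twist

/-- `Pic^k(Γ₀)`. -/
def PicOfDegree (k : ℤ) : Set Γ₀.Pic := {x | Γ₀.picDegree x = k}

end ConnectedSubgraph

end HalfEdgeGraph

open scoped Classical in
/-- A stable graph of genus `g` whose legs are indexed by `L`.  In particular, `StableGraph g (Fin n)`
is the type of stable graphs of type `(g, n)`. -/
structure StableGraph (g : ℕ) (L : Type) [Fintype L] extends HalfEdgeGraph where
  leg : L → V
  nonempty : Nonempty V
  connected : ∀ v w, Relation.ReflTransGen (toHalfEdgeGraph.Step Finset.univ) v w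
  stable : ∀ v, 2 < 2 * genus v + (Finset.univ.filter fun h => root h = v).card
    + (Finset.univ.filter fun l => leg l = v).card
  genus_eq : ∑ v, genus v + toHalfEdgeGraph.edgeCount Finset.univ + 1 = g + Fintype.card V

/-- An isomorphism of stable graphs; it may identify the legs through any bijection `legs`. -/
structure StableGraphIso {g : ℕ} {L L' : Type} [Fintype L] [Fintype L']
    (Γ : StableGraph g L) (Γ' : StableGraph g L') where
  vert : Γ.V ≃ Γ'.V
  half : Γ.H ≃ Γ'.H
  legs : L ≃ L'
  root_half : ∀ h, Γ'.root (half h) = vert (Γ.root h)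
  flip_half : ∀ h, Γ'.flip (half h) = half (Γ.flip h)
  leg_legs : ∀ l, Γ'.leg (legs l) = vert (Γ.leg l)
  genus_vert : ∀ v, Γ'.genus (vert v) = Γ.genus v

/-- `f` pulls the subgraph `Γ₀'` of the target back to the subgraph `Γ₀` of the source. -/
def StableGraphIso.Pullback {g : ℕ} {L L' : Type} [Fintype L] [Fintype L']
    {Γ : StableGraph g L} {Γ' : StableGraph g L'} (f : StableGraphIso Γ Γ')
    (Γ₀ : Γ.ConnectedSubgraph) (Γ₀' : Γ'.ConnectedSubgraph) : Prop :=
  ∀ h, h ∈ Γ₀.halfEdges ↔ f.half h ∈ Γ₀'.halfEdges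

open scoped Classical in
/-- A morphism of stable graphs `Γ → Γ'` with the same legs, contracting a subgraph of `Γ`: the
half-edges of `Γ'` are those half-edges of `Γ` that are not contracted, each fibre over a vertex
of `Γ'` is connected by contracted edges, and the genus of a vertex of `Γ'` is the genus
(vertex genera plus first Betti number) of the part of `Γ` contracted to it. -/
structure StableGraphContraction {g : ℕ} {L : Type} [Fintype L] (Γ Γ' : StableGraph g L) where
  vert : Γ.V → Γ'.V
  vert_surjective : Function.Surjective vert
  half : Γ'.H → Γ.H
  half_injective : Function.Injective half
  flip_half : ∀ h, Γ.flip (half h) = half (Γ'.flip h)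
  root_half : ∀ h, vert (Γ.root (half h)) = Γ'.root h
  leg_eq : ∀ l, vert (Γ.leg l) = Γ'.leg l
  root_contracted : ∀ h, h ∉ Set.range half → vert (Γ.root h) = vert (Γ.root (Γ.flip h))
  fibre_connected : ∀ v w, vert v = vert w → Relation.ReflTransGen
    (Γ.Step (Finset.univ.filter fun h => h ∉ Set.range half)) v w
  genus_eq : ∀ v', Γ'.genus v' + (Finset.univ.filter fun v => vert v = v').card =
    ∑ v with vert v = v', Γ.genus v + Γ.edgeCount (Finset.univ.filter fun h =>
      h ∉ Set.range half ∧ vert (Γ.root h) = v') + 1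

namespace StableGraphContraction

variable {g : ℕ} {L : Type} [Fintype L] {Γ Γ' : StableGraph g L}

open scoped Classical in
/-- The induced multidegree on `Γ'`: sum the degrees over each fibre, adding one for every
contracted edge that is not in `Γ₀`. -/
def pushforward (f : StableGraphContraction Γ Γ') (Γ₀ : Γ.ConnectedSubgraph) (D : Γ.V → ℤ) :
    Γ'.V → ℤ := fun v' =>
  ∑ v with f.vert v = v', D v + (Γ.edgeCount (Finset.univ.filter fun h =>
    h ∉ Set.range f.half ∧ h ∉ Γ₀.halfEdges ∧ f.vert (Γ.root h) = v') : ℤ)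

end StableGraphContraction

/-- A triple `(Γ, Γ₀, D)`: a stable graph of type `(g, n)`, a connected subgraph containing all
vertices, and a multidegree. -/
structure StableTriple (g n : ℕ) where
  Γ : StableGraph g (Fin n)
  Γ₀ : Γ.ConnectedSubgraph
  D : Γ.V → ℤ

open scoped Classical in
/-- A Pagani--Tommasi stability condition of degree `d` over the moduli space of stable curves
of type `(g, n)`. -/
structure IsPaganiTommasi (g n : ℕ) (d : ℤ) (σ : Set (StableTriple g n)) : Prop where
  /-- The multidegrees form a minimal set of representatives for `Pic^{d - e}(Γ₀)`. -/
  representatives : ∀ (Γ : StableGraph g (Fin n)) (Γ₀ : Γ.ConnectedSubgraph),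
    Set.BijOn (fun D : Γ.V → ℤ => (QuotientAddGroup.mk D : Γ₀.Pic))
      {D | ⟨Γ, Γ₀, D⟩ ∈ σ} (Γ₀.PicOfDegree (d - Γ₀.missingEdges))
  /-- Invariance under isomorphisms of stable graphs. -/
  iso_iff : ∀ (Γ' Γ : StableGraph g (Fin n)) (f : StableGraphIso Γ' Γ), f.legs = Equiv.refl _ →
    ∀ (Γ₀' : Γ'.ConnectedSubgraph) (Γ₀ : Γ.ConnectedSubgraph), f.Pullback Γ₀' Γ₀ →
    ∀ D : Γ.V → ℤ, ⟨Γ, Γ₀, D⟩ ∈ σ ↔ ⟨Γ', Γ₀', D ∘ f.vert⟩ ∈ σ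
  /-- Compatibility with adding an edge `{h, flip h}` to `Γ₀`; as `h` is an arbitrary half-edge, a
  unit of degree may be added at either end. -/
  add_edge : ∀ (Γ : StableGraph g (Fin n)) (Γ₀ Γ₁ : Γ.ConnectedSubgraph) (h : Γ.H),
    h ∉ Γ₀.halfEdges → Γ₁.halfEdges = insert h (insert (Γ.flip h) Γ₀.halfEdges) →
    ∀ D : Γ.V → ℤ, ⟨Γ, Γ₀, D⟩ ∈ σ → ⟨Γ, Γ₁, D + Pi.single (Γ.root h) 1⟩ ∈ σ
  /-- Compatibility with contractions. -/
  contract : ∀ (Γ Γ' : StableGraph g (Fin n)) (f : StableGraphContraction Γ Γ')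
    (Γ₀ : Γ.ConnectedSubgraph) (Γ₀' : Γ'.ConnectedSubgraph),
    (∀ h, h ∈ Γ₀'.halfEdges ↔ f.half h ∈ Γ₀.halfEdges) →
    ∀ D : Γ.V → ℤ, ⟨Γ, Γ₀, D⟩ ∈ σ → ⟨Γ', Γ₀', f.pushforward Γ₀ D⟩ ∈ σ

open scoped Classical in
/-- Relabel the legs of a stable graph along a bijection. -/
abbrev StableGraph.relabel {g : ℕ} {L L' : Type} [Fintype L] [Fintype L'] (Γ : StableGraph g L)
    (e : L ≃ L') : StableGraph g L' where
  toHalfEdgeGraph := Γ.toHalfEdgeGraph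
  leg := Γ.leg ∘ e.symm
  nonempty := Γ.nonempty
  connected := Γ.connected
  stable v := by
    have h := Γ.stable v
    have : (Finset.univ.filter fun l => (Γ.leg ∘ e.symm) l = v).card =
        (Finset.univ.filter fun l => Γ.leg l = v).card :=
      Finset.card_equiv e.symm (by simp)
    rw [this]; exact h
  genus_eq := Γ.genus_eq

/-- The subgroup `S_{n_1} × ⋯ × S_{n_p}` of `S_n` attached to a partition of the `n` labels into
`p` parts of sizes `n_1, …, n_p`, the parts being the fibres of `c`. -/
def youngSubgroup {n p : ℕ} (c : Fin n → Fin p) : Subgroup (Equiv.Perm (Fin n)) where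
  carrier := {π | ∀ i, c (π i) = c i}
  mul_mem' {a b} ha hb i := by simpa using (ha (b i)).trans (hb i)
  one_mem' i := by simp
  inv_mem' {a} ha i := by simpa using (ha (a⁻¹ i)).symm

/-- Invariance of a collection of triples under a group of permutations of the `n` labels. -/
def IsLabelInvariant {g n : ℕ} (G : Subgroup (Equiv.Perm (Fin n)))
    (σ : Set (StableTriple g n)) : Prop :=
  ∀ π ∈ G, ∀ (Γ : StableGraph g (Fin n)) (Γ₀ : Γ.ConnectedSubgraph) (D : Γ.V → ℤ),
    ⟨Γ, Γ₀, D⟩ ∈ σ ↔ ⟨Γ.relabel π, Γ₀, D⟩ ∈ σ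

section Coloured

variable {g n p : ℕ} {L : Type} [Fintype L]

/-- The set `{D : (Γ, Γ₀, D) ∈ σ}` for a stable graph `Γ` whose legs only carry one of `p`
labels (`col`): the legs are numbered compatibly with the partition `c` of `{1, …, n}`.  If `σ` is
invariant under `youngSubgroup c` the choice of numbering is irrelevant
(`mem_colouredMultidegrees_iff`). -/
def colouredMultidegrees (σ : Set (StableTriple g n)) (c : Fin n → Fin p) (Γ : StableGraph g L)
    (col : L → Fin p) (Γ₀ : Γ.ConnectedSubgraph) : Set (Γ.V → ℤ) :=
  {D | ∃ e : L ≃ Fin n, (∀ l, c (e l) = col l) ∧ ⟨Γ.relabel e, Γ₀, D⟩ ∈ σ}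

theorem mem_colouredMultidegrees_iff {σ : Set (StableTriple g n)} {c : Fin n → Fin p}
    (hσ : IsLabelInvariant (youngSubgroup c) σ) (Γ : StableGraph g L) (col : L → Fin p)
    (Γ₀ : Γ.ConnectedSubgraph) (D : Γ.V → ℤ) (e : L ≃ Fin n) (he : ∀ l, c (e l) = col l) :
    D ∈ colouredMultidegrees σ c Γ col Γ₀ ↔ ⟨Γ.relabel e, Γ₀, D⟩ ∈ σ := by
  refine ⟨?_, fun h => ⟨e, he, h⟩⟩
  rintro ⟨e', he', h⟩
  have hπ : e'.symm.trans e ∈ youngSubgroup c := fun i => by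
    have := he' (e'.symm i)
    simp only [Equiv.apply_symm_apply] at this
    simp [he, this]
  have h' := (hσ _ hπ (Γ.relabel e') Γ₀ D).1 h
  have hleg : (Γ.leg ∘ e'.symm) ∘ (e'.symm.trans e).symm = Γ.leg ∘ e.symm := by
    ext i; simp
  simp only [StableGraph.relabel] at h' ⊢
  convert h' using 4
  simpa using hleg.symm

/-- The elements of `Aut(Γ, Γ₀)`: automorphisms of `Γ` that preserve the labels `col` of the legs
and send `Γ₀` to itself. -/
def IsColouredAut {Γ : StableGraph g L} (col : L → Fin p) (Γ₀ : Γ.ConnectedSubgraph)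
    (f : StableGraphIso Γ Γ) : Prop :=
  (∀ l, col (f.legs l) = col l) ∧ f.Pullback Γ₀ Γ₀

end Coloured

end

/-! Pulling back a multidegree along an automorphism depends only on the permutation of vertices, so
the group acting is the finite group `vertexAutGroup`. Two finite sets with an action of a finite
group are isomorphic once every subgroup H has equally many fixed points on both
(`exists_equivariant_bijOn`), so it suffices to count the H-invariant multidegrees in σ and σ'.

By uniqueness of representatives, the member of σ in the class of an H-invariant multidegree is
itself H-invariant (`exists_invariant_representative`). The count is therefore the number of classes
of degree d - e having an H-invariant representative, where e is the number of edges outside Γ₀. If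
there are any, they form a coset of a group independent of d. What remains is that d - e and d' - e
lie simultaneously in the group I_H of degrees of H-invariant multidegrees
(`mem_invariantDegrees_transfer`).

Here the existence of σ on other graphs of the same type restricts d. If m ≥ 2 divides g - 1 and
every n_k, a cycle of m equal vertices shows that m does not divide d (`not_dvd_degree`). If g and
all n_k are even, two equal vertices joined by an edge show that d is even (`two_dvd_degree`). Since
I_H contains |V|, the sum of the vertex genera, 2|E|, 2|E(Γ₀)| and the n_k, an odd prime dividing
I_H prevents d - e from lying in I_H. At the prime 2 the parity of d is forced to be that of g, and
membership comes down to a condition on |E(Γ₀)| alone. -/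

noncomputable section

/-! ### Finite G-sets and their fixed-point counts -/

theorem ncard_sep_eq_add {Z : Type*} {A B : Set Z} (P : Z → Prop) (hBA : B ⊆ A) (hA : A.Finite) :
    {z ∈ A | P z}.ncard = {z ∈ A \ B | P z}.ncard + {z ∈ B | P z}.ncard := by
  rw [← Set.ncard_union_eq _ (hA.subset fun z hz => hz.1.1) (hA.subset fun z hz => hBA hz.1)]
  · congr 1
    ext z
    have := @hBA z
    simp only [Set.mem_ofPred_eq, Set.mem_union, Set.mem_sdiff]
    tauto
  · rw [Set.disjoint_left]
    rintro z ⟨⟨-, hz⟩, -⟩ ⟨hz', -⟩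
    exact hz hz'

theorem smul_mem_orbit_iff {G Z : Type*} [Group G] [MulAction G Z] (x : Z) (g : G) (z : Z) :
    g • z ∈ MulAction.orbit G x ↔ z ∈ MulAction.orbit G x := by
  rw [← MulAction.orbit_eq_iff, MulAction.orbit_smul, MulAction.orbit_eq_iff]

/-- Finite invariant sets `S`, `T` in two `G`-sets with the same number of points fixed by each
subgroup of `G` are isomorphic as `G`-sets. -/
theorem exists_equivariant_bijOn {G X Y : Type*} [Group G] [Finite G] [MulAction G X]
    [MulAction G Y] [Nonempty Y] (N : ℕ) (S : Set X) (T : Set Y) (hS : S.Finite) (hT : T.Finite)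
    (hN : S.ncard = N)
    (hSG : ∀ (g : G), ∀ x ∈ S, g • x ∈ S) (hTG : ∀ (g : G), ∀ y ∈ T, g • y ∈ T)
    (h : ∀ H : Subgroup G, {x ∈ S | ∀ g ∈ H, g • x = x}.ncard =
      {y ∈ T | ∀ g ∈ H, g • y = y}.ncard) :
    ∃ f : X → Y, Set.BijOn f S T ∧ ∀ (g : G), ∀ x ∈ S, f (g • x) = g • f x := by
  classical
  induction N using Nat.strong_induction_on generalizing S T with
  | _ N ih =>
  have hTx : ∀ H : Subgroup G, (∃ x ∈ S, ∀ g ∈ H, g • x = x) ↔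
      ∃ y ∈ T, ∀ g ∈ H, g • y = y := by
    intro H
    have h1 := Set.ncard_pos (s := {x ∈ S | ∀ g ∈ H, g • x = x}) (hS.subset (Set.sep_subset _ _))
    have h2 := Set.ncard_pos (s := {y ∈ T | ∀ g ∈ H, g • y = y}) (hT.subset (Set.sep_subset _ _))
    rw [h H, h2] at h1
    exact h1.symm
  rcases S.eq_empty_or_nonempty with rfl | hne
  · have hTe : T = ∅ := by
      by_contra hT0
      obtain ⟨y, hy⟩ := Set.nonempty_iff_ne_empty.2 hT0
      obtain ⟨x, hx, -⟩ := (hTx ⊥).2 ⟨y, hy, by simp⟩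
      exact hx
    subst hTe
    exact ⟨fun _ => Classical.arbitrary Y, by simp, by simp⟩
  -- A stabilizer of maximal order occurs on both sides: its fixed point y in T can only have a
  -- larger stabilizer, and a point of S fixed by that one bounds its order. The orbits of x and y
  -- are then isomorphic and can be split off.
  obtain ⟨x, hxS, hmax⟩ := Set.exists_max_image S (fun x => Nat.card (MulAction.stabilizer G x))
    hS hne
  obtain ⟨y, hyT, hy⟩ := (hTx (MulAction.stabilizer G x)).1 ⟨x, hxS, fun g hg => hg⟩
  have hle : MulAction.stabilizer G x ≤ MulAction.stabilizer G y := hy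
  have hstab : MulAction.stabilizer G x = MulAction.stabilizer G y := by
    obtain ⟨x', hx'S, hx'⟩ := (hTx (MulAction.stabilizer G y)).2 ⟨y, hyT, fun g hg => hg⟩
    have hle' : MulAction.stabilizer G y ≤ MulAction.stabilizer G x' := hx'
    refine Subgroup.eq_of_le_of_card_ge hle ((Subgroup.card_le_of_le hle').trans (hmax x' hx'S))
  have hxy : ∀ a b : G, a • x = b • x ↔ a • y = b • y := by
    intro a b
    have e1 : a • x = b • x ↔ b⁻¹ * a ∈ MulAction.stabilizer G x := by
      rw [MulAction.mem_stabilizer_iff, mul_smul, inv_smul_eq_iff]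
    have e2 : a • y = b • y ↔ b⁻¹ * a ∈ MulAction.stabilizer G y := by
      rw [MulAction.mem_stabilizer_iff, mul_smul, inv_smul_eq_iff]
    rw [e1, e2, hstab]
  -- The map a • x ↦ a • y, well defined because the stabilizers agree. The value outside the orbit
  -- is never used.
  let f₀ : X → Y := fun z => if hz : ∃ g : G, g • x = z then hz.choose • y else y
  have hf₀ : ∀ g : G, f₀ (g • x) = g • y := by
    intro g
    have hz : ∃ a : G, a • x = g • x := ⟨g, rfl⟩
    simp only [f₀, dif_pos hz]
    exact (hxy _ _).1 hz.choose_spec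
  have horb : ∀ H : Subgroup G, {z ∈ MulAction.orbit G x | ∀ g ∈ H, g • z = z}.ncard =
      {z ∈ MulAction.orbit G y | ∀ g ∈ H, g • z = z}.ncard := by
    intro H
    refine Set.BijOn.ncard_eq (f := f₀) ⟨?_, ?_, ?_⟩
    · rintro _ ⟨⟨a, rfl⟩, ha⟩
      refine ⟨⟨a, (hf₀ a).symm⟩, fun g hg => ?_⟩
      have := ha g hg
      simp only [smul_smul] at this
      simp only [hf₀, smul_smul]
      exact (hxy _ _).1 this
    · rintro _ ⟨⟨a, rfl⟩, -⟩ _ ⟨⟨b, rfl⟩, -⟩ hab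
      simp only [hf₀] at hab
      exact (hxy _ _).2 hab
    · rintro _ ⟨⟨a, rfl⟩, ha⟩
      refine ⟨a • x, ⟨⟨a, rfl⟩, fun g hg => ?_⟩, hf₀ a⟩
      have := ha g hg
      simp only [smul_smul] at this ⊢
      exact (hxy _ _).2 this
  have hxo : MulAction.orbit G x ⊆ S := by rintro _ ⟨g, rfl⟩; exact hSG g x hxS
  have hyo : MulAction.orbit G y ⊆ T := by rintro _ ⟨g, rfl⟩; exact hTG g y hyT
  have horbx : ∀ (g : G) (z : X), g • z ∈ MulAction.orbit G x ↔ z ∈ MulAction.orbit G x :=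
    smul_mem_orbit_iff x
  obtain ⟨f, hf, hfe⟩ := ih (S \ MulAction.orbit G x).ncard
    (hN ▸ Set.ncard_lt_ncard (Set.sdiff_ssubset_left_iff.2
      ⟨x, hxS, MulAction.mem_orbit_self x⟩) hS)
    (S \ MulAction.orbit G x) (T \ MulAction.orbit G y) (hS.subset Set.sdiff_subset)
    (hT.subset Set.sdiff_subset) rfl
    (fun g z hz => ⟨hSG g z hz.1, fun h' => hz.2 ((horbx g z).1 h')⟩)
    (fun g z hz => ⟨hTG g z hz.1, fun h' => hz.2 ((smul_mem_orbit_iff y g z).1 h')⟩)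
    -- The two orbits have equal fixed-point counts, so removing them preserves the equality of
    -- counts.
    (fun H => by
      have h1 := ncard_sep_eq_add (fun z => ∀ g ∈ H, g • z = z) hxo hS
      have h2 := ncard_sep_eq_add (fun z => ∀ g ∈ H, g • z = z) hyo hT
      have := h H
      have := horb H
      omega)
  refine ⟨fun z => if z ∈ MulAction.orbit G x then f₀ z else f z, ⟨?_, ?_, ?_⟩, ?_⟩
  · intro z hz
    by_cases hzo : z ∈ MulAction.orbit G x
    · obtain ⟨g, rfl⟩ := hzo
      simpa [hf₀] using hTG g y hyT
    · simpa [hzo] using (hf.mapsTo ⟨hz, hzo⟩).1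
  · intro z hz w hw hzw
    by_cases hzo : z ∈ MulAction.orbit G x <;> by_cases hwo : w ∈ MulAction.orbit G x
    · obtain ⟨a, rfl⟩ := hzo
      obtain ⟨b, rfl⟩ := hwo
      simp only [MulAction.mem_orbit, if_true, hf₀] at hzw
      exact (hxy _ _).2 hzw
    · simp only [hzo, hwo, if_true, if_false] at hzw
      obtain ⟨a, rfl⟩ := hzo
      exact absurd ⟨a, by simpa [hf₀] using hzw⟩ (hf.mapsTo ⟨hw, hwo⟩).2
    · simp only [hzo, hwo, if_true, if_false] at hzw
      obtain ⟨a, rfl⟩ := hwo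
      exact absurd ⟨a, by simpa [hf₀] using hzw.symm⟩ (hf.mapsTo ⟨hz, hzo⟩).2
    · simp only [hzo, hwo, if_false] at hzw
      exact hf.injOn ⟨hz, hzo⟩ ⟨hw, hwo⟩ hzw
  · intro w hw
    by_cases hwo : w ∈ MulAction.orbit G y
    · obtain ⟨a, rfl⟩ := hwo
      exact ⟨a • x, hSG a x hxS, by simp [hf₀]⟩
    · obtain ⟨z, hz, rfl⟩ := hf.surjOn ⟨hw, hwo⟩
      exact ⟨z, hz.1, by simp only [if_neg hz.2]⟩
  · intro g z hz
    by_cases hzo : z ∈ MulAction.orbit G x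
    · simp only [horbx, hzo, if_true]
      obtain ⟨a, rfl⟩ := hzo
      simp only [smul_smul, hf₀]
    · simp only [horbx, hzo, if_false]
      exact hfe g z ⟨hz, hzo⟩

/-! ### Edge counts and finiteness of the Picard sets -/

namespace HalfEdgeGraph

variable (Γ : HalfEdgeGraph)

theorem two_mul_edgeCount (S : Finset Γ.H) (hS : ∀ h ∈ S, Γ.flip h ∈ S) :
    2 * Γ.edgeCount S = S.card := by
  classical
  unfold edgeCount
  rw [Finset.card_eq_sum_card_image (fun h => s(h, Γ.flip h)) S, Finset.sum_const_nat (m := 2),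
    mul_comm]
  · intro b hb
    obtain ⟨h, hh, rfl⟩ := Finset.mem_image.1 hb
    have : (S.filter fun a => s(a, Γ.flip a) = s(h, Γ.flip h)) = {h, Γ.flip h} := by
      ext a
      simp only [Finset.mem_filter, Sym2.eq_iff, Finset.mem_insert, Finset.mem_singleton]
      constructor
      · rintro ⟨-, ⟨h1, -⟩ | ⟨h1, -⟩⟩ <;> simp [h1]
      · rintro (rfl | rfl)
        · exact ⟨hh, Or.inl ⟨rfl, rfl⟩⟩
        · exact ⟨hS _ hh, Or.inr ⟨rfl, Γ.flip_flip _⟩⟩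
    rw [this, Finset.card_pair (Γ.flip_ne h).symm]

namespace ConnectedSubgraph

variable {Γ} (Γ₀ : Γ.ConnectedSubgraph)

theorem edgeCount_univ :
    Γ.edgeCount Finset.univ = Γ.edgeCount Γ₀.halfEdges + Γ₀.missingEdges := by
  classical
  have h1 := Γ.two_mul_edgeCount Finset.univ (by simp)
  have h2 := Γ.two_mul_edgeCount _ Γ₀.flip_mem
  have h3 := Γ.two_mul_edgeCount Γ₀.halfEdgesᶜ (fun h hh => by
    simp only [Finset.mem_compl] at hh ⊢
    intro h'
    exact hh (by simpa [Γ.flip_flip] using Γ₀.flip_mem _ h'))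
  have h4 := Finset.card_compl_add_card Γ₀.halfEdges
  have h5 : Γ₀.missingEdges = Γ.edgeCount Γ₀.halfEdgesᶜ := by
    unfold missingEdges
    congr!
  rw [Finset.card_univ] at h1
  omega

open scoped Classical in
/-- A harmonic function on a connected graph is constant. -/
theorem eq_of_harmonic (ψ : Γ.V → ℤ)
    (hψ : ∀ v, ∑ h ∈ Γ₀.halfEdges with Γ.root h = v, (ψ (Γ.root (Γ.flip h)) - ψ v) = 0)
    (v w : Γ.V) : ψ v = ψ w := by
  obtain ⟨m, hm⟩ := @Finite.exists_max _ _ _ ⟨v⟩ _ ψ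
  have key : ∀ w, Relation.ReflTransGen (Γ.Step Γ₀.halfEdges) m w → ψ w = ψ m := by
    intro w hw
    induction hw with
    | refl => rfl
    | @tail b c _ hbc ih =>
      obtain ⟨h, hh, rfl, rfl⟩ := hbc
      -- Maximum principle: at a vertex where ψ is maximal all summands are nonpositive, so each of
      -- them vanishes.
      have h0 := hψ (Γ.root h)
      have h1 := (Finset.sum_eq_zero_iff_of_nonpos (fun h' _ => by
        have := hm (Γ.root (Γ.flip h')); omega)).1 h0 h (by simp [hh])
      omega
  rw [key v (Γ₀.connected m v), key w (Γ₀.connected m w)]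

theorem mk_eq_sum [DecidableEq Γ.V] (D : Γ.V → ℤ) : (QuotientAddGroup.mk D : Γ₀.Pic) =
    ∑ v, D v • QuotientAddGroup.mk (Pi.single v 1) := by
  have hD : D = ∑ v, D v • Pi.single v 1 := by
    ext w
    simp [Finset.sum_apply, Pi.single_apply]
  conv_lhs => rw [hD]
  exact (map_sum (QuotientAddGroup.mk' Γ₀.twist) _ _).trans
    (Finset.sum_congr rfl fun v _ => map_zsmul (QuotientAddGroup.mk' Γ₀.twist) _ _)

/-- A homomorphism to ℤ is a function on the vertices that kills all twists, which is exactly a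
harmonic function, hence constant. -/
theorem hom_apply (f : Γ₀.Pic →+ ℤ) : ∃ c : ℤ, ∀ x, f x = c * Γ₀.picDegree x := by
  classical
  rcases isEmpty_or_nonempty Γ.V with hV | ⟨⟨v₀⟩⟩
  · refine ⟨0, fun x => ?_⟩
    obtain ⟨D, rfl⟩ := QuotientAddGroup.mk_surjective x
    have : D = 0 := Subsingleton.elim _ _
    subst this
    simp
  · let ψ : Γ.V → ℤ := fun v => f (QuotientAddGroup.mk (Pi.single v 1))
    have hψ := Γ₀.eq_of_harmonic ψ (fun v => by
      have h1 : (QuotientAddGroup.mk (Γ₀.twistAt v) : Γ₀.Pic) = 0 :=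
        (QuotientAddGroup.eq_zero_iff _).2 (AddSubgroup.subset_closure ⟨v, rfl⟩)
      have h2 : f.comp (QuotientAddGroup.mk' Γ₀.twist) (Γ₀.twistAt v) = 0 :=
        (congrArg f h1).trans (map_zero f)
      rw [twistAt, map_sum] at h2
      simp only [map_sub] at h2
      exact h2)
    refine ⟨ψ v₀, fun x => ?_⟩
    obtain ⟨D, rfl⟩ := QuotientAddGroup.mk_surjective x
    have : ∀ v, f (QuotientAddGroup.mk (Pi.single v 1)) = ψ v₀ := fun v => hψ v v₀
    have hD : f (QuotientAddGroup.mk D) = ψ v₀ * ∑ v, D v := by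
      rw [Γ₀.mk_eq_sum D, map_sum]
      simp only [map_zsmul, this, smul_eq_mul, ← Finset.sum_mul]
      rw [mul_comm]
    exact hD

/-- The Picard group is finitely generated, so its torsion is finite. Its torsion-free quotient is
detected by homomorphisms to ℤ, all multiples of the degree, so classes of degree 0 are torsion. The
other degrees are empty or contained in translates. -/
theorem finite_picOfDegree (k : ℤ) : (Γ₀.PicOfDegree k).Finite := by
  have : Module.Finite ℤ Γ₀.Pic :=
    Module.Finite.of_surjective (QuotientAddGroup.mk' Γ₀.twist).toIntLinearMap
      (QuotientAddGroup.mk'_surjective _)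
  have hfin : (Submodule.torsion ℤ Γ₀.Pic : Set Γ₀.Pic).Finite := by
    exact @Set.toFinite _ _ (Module.finite_of_fg_torsion (Submodule.torsion ℤ Γ₀.Pic)
      Submodule.torsion_isTorsion)
  have hker : ∀ x, Γ₀.picDegree x = 0 → x ∈ Submodule.torsion ℤ Γ₀.Pic := by
    intro x hx
    rw [← Submodule.Quotient.mk_eq_zero, ← Module.forall_dual_apply_eq_zero_iff ℤ]
    intro φ
    obtain ⟨c, hc⟩ := Γ₀.hom_apply (φ.comp (Submodule.mkQ _)).toAddMonoidHom
    have := hc x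
    rw [hx, mul_zero] at this
    exact this
  rcases (Γ₀.PicOfDegree k).eq_empty_or_nonempty with he | ⟨x₀, hx₀⟩
  · simp [he]
  · refine (hfin.image (fun x => x + x₀)).subset fun x hx => ⟨x - x₀, hker _ ?_, by simp⟩
    have h1 : Γ₀.picDegree x = k := hx
    have h2 : Γ₀.picDegree x₀ = k := hx₀
    rw [map_sub, h1, h2, sub_self]

end ConnectedSubgraph

end HalfEdgeGraph

/-! ### Degrees of invariant multidegrees -/

namespace HalfEdgeGraph

variable (Γ : HalfEdgeGraph)

/-- The multidegrees that are invariant under a group of permutations of the vertices. -/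
def invariantMultidegrees (H : Subgroup (Equiv.Perm Γ.V)) : AddSubgroup (Γ.V → ℤ) where
  carrier := {D | ∀ a ∈ H, D ∘ a = D}
  zero_mem' _ _ := rfl
  add_mem' {D E} hD hE a ha := by
    have h1 := hD a ha
    have h2 := hE a ha
    ext v
    exact congrArg₂ (· + ·) (congrFun h1 v) (congrFun h2 v)
  neg_mem' {D} hD a ha := by
    have h1 := hD a ha
    ext v
    exact congrArg Neg.neg (congrFun h1 v)

/-- The total degrees of the invariant multidegrees. -/
def invariantDegrees (H : Subgroup (Equiv.Perm Γ.V)) : AddSubgroup ℤ :=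
  (Γ.invariantMultidegrees H).map Γ.degree

variable {Γ}

theorem sum_mem_invariantDegrees {H : Subgroup (Equiv.Perm Γ.V)} {D : Γ.V → ℤ}
    (hD : ∀ a ∈ H, ∀ v, D (a v) = D v) : ∑ v, D v ∈ Γ.invariantDegrees H :=
  ⟨D, fun a ha => funext (hD a ha), rfl⟩

/-- The fibre sizes of r on S form an invariant multidegree of degree |S|. This applies to vertices,
half-edges and legs. -/
theorem card_mem_invariantDegrees {H : Subgroup (Equiv.Perm Γ.V)} {T : Type*} (S : Finset T)
    (r : T → Γ.V) (hS : ∀ a ∈ H, ∃ b : Equiv.Perm T, (∀ t, b t ∈ S ↔ t ∈ S) ∧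
      ∀ t, r (b t) = a (r t)) : (S.card : ℤ) ∈ Γ.invariantDegrees H := by
  classical
  have h := sum_mem_invariantDegrees (H := H) (D := fun v => ((S.filter fun t => r t = v).card : ℤ))
    (fun a ha v => by
      obtain ⟨b, hb, hr⟩ := hS a ha
      congr 1
      exact (Finset.card_equiv b fun t => by simp [hb, hr]).symm)
  rwa [← Nat.cast_sum, ← Finset.card_eq_sum_card_fiberwise (s := S) (f := r)
    (fun _ _ => Finset.mem_univ _)] at h

end HalfEdgeGraph

/-! ### Automorphisms acting on multidegrees and classes -/

section Iso

variable {g n p : ℕ} {L : Type} [Fintype L] {Γ : StableGraph g L}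

/-- The composite of two automorphisms. -/
def StableGraphIso.comp (f f' : StableGraphIso Γ Γ) : StableGraphIso Γ Γ where
  vert := f'.vert.trans f.vert
  half := f'.half.trans f.half
  legs := f'.legs.trans f.legs
  root_half h := by simp [f.root_half, f'.root_half]
  flip_half h := by simp [f.flip_half, f'.flip_half]
  leg_legs l := by simp [f.leg_legs, f'.leg_legs]
  genus_vert v := by simp [f.genus_vert, f'.genus_vert]

/-- The identity automorphism. -/
def StableGraphIso.id (Γ : StableGraph g L) : StableGraphIso Γ Γ where
  vert := Equiv.refl _
  half := Equiv.refl _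
  legs := Equiv.refl _
  root_half _ := rfl
  flip_half _ := rfl
  leg_legs _ := rfl
  genus_vert _ := rfl

/-- The inverse of an automorphism. -/
def StableGraphIso.inv (f : StableGraphIso Γ Γ) : StableGraphIso Γ Γ where
  vert := f.vert.symm
  half := f.half.symm
  legs := f.legs.symm
  root_half h := by rw [Equiv.eq_symm_apply, ← f.root_half, Equiv.apply_symm_apply]
  flip_half h := by rw [Equiv.eq_symm_apply, ← f.flip_half, Equiv.apply_symm_apply]
  leg_legs l := by rw [Equiv.eq_symm_apply, ← f.leg_legs, Equiv.apply_symm_apply]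
  genus_vert v := by rw [← f.genus_vert, Equiv.apply_symm_apply]

/-- The permutations of the vertices induced by `Aut(Γ, Γ₀)`. -/
def vertexAutGroup (col : L → Fin p) (Γ₀ : Γ.ConnectedSubgraph) :
    Subgroup (Equiv.Perm Γ.V) where
  carrier := {a | ∃ f : StableGraphIso Γ Γ, IsColouredAut col Γ₀ f ∧ f.vert = a}
  one_mem' := ⟨StableGraphIso.id Γ, ⟨fun _ => rfl, fun _ => Iff.rfl⟩, rfl⟩
  mul_mem' := by
    rintro _ _ ⟨f, hf, rfl⟩ ⟨f', hf', rfl⟩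
    refine ⟨f.comp f', ⟨fun l => ?_, fun h => ?_⟩, rfl⟩
    · exact (hf.1 _).trans (hf'.1 l)
    · exact (hf'.2 h).trans (hf.2 _)
  inv_mem' := by
    rintro _ ⟨f, hf, rfl⟩
    refine ⟨f.inv, ⟨fun l => ?_, fun h => ?_⟩, rfl⟩
    · simpa [StableGraphIso.inv] using (hf.1 (f.legs.symm l)).symm
    · simpa [StableGraphIso.inv] using (hf.2 (f.half.symm h)).symm

/-- Pullback along f permutes the generators: the twist at f(v) goes to the twist at v. -/
theorem comp_mem_twist {Γ₀ : Γ.ConnectedSubgraph} {f : StableGraphIso Γ Γ}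
    (hf : f.Pullback Γ₀ Γ₀) {D : Γ.V → ℤ} (hD : D ∈ Γ₀.twist) : D ∘ f.vert ∈ Γ₀.twist := by
  classical
  let F : (Γ.V → ℤ) →+ (Γ.V → ℤ) :=
    { toFun := fun D => D ∘ f.vert, map_zero' := rfl, map_add' := fun _ _ => rfl }
  have hsingle : ∀ v, F (Pi.single (f.vert v) 1) = Pi.single v 1 := by
    intro v
    ext w
    simp [F, Pi.single_apply]
  have key : Γ₀.twist ≤ Γ₀.twist.comap F := by
    refine (AddSubgroup.closure_le _).2 ?_
    rintro _ ⟨v, rfl⟩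
    obtain ⟨v, rfl⟩ := f.vert.surjective v
    have : F (Γ₀.twistAt (f.vert v)) = Γ₀.twistAt v := by
      unfold HalfEdgeGraph.ConnectedSubgraph.twistAt
      rw [map_sum]
      symm
      refine Finset.sum_equiv f.half (fun h => ?_) fun h _ => ?_
      · simp [hf h, f.root_half]
      · rw [map_sub, f.flip_half, f.root_half]
        congr 1
        · convert (hsingle _).symm
        · convert (hsingle _).symm
    exact AddSubgroup.subset_closure ⟨v, this.symm⟩
  exact key hD

/-- Composing the numbering with the leg permutation of f turns f into an isomorphism of numbered
graphs fixing every number, to which the invariance axiom of σ applies. -/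
theorem comp_mem_colouredMultidegrees {d : ℤ} {σ : Set (StableTriple g n)}
    (hσ : IsPaganiTommasi g n d σ) (c : Fin n → Fin p) {col : L → Fin p}
    {Γ₀ : Γ.ConnectedSubgraph} {f : StableGraphIso Γ Γ} (hf : IsColouredAut col Γ₀ f)
    {D : Γ.V → ℤ} (hD : D ∈ colouredMultidegrees σ c Γ col Γ₀) :
    D ∘ f.vert ∈ colouredMultidegrees σ c Γ col Γ₀ := by
  obtain ⟨e, he, h⟩ := hD
  refine ⟨f.legs.trans e, fun l => (he _).trans (hf.1 l), ?_⟩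
  let F : StableGraphIso (Γ.relabel (f.legs.trans e)) (Γ.relabel e) :=
    { vert := f.vert
      half := f.half
      legs := Equiv.refl _
      root_half := f.root_half
      flip_half := f.flip_half
      leg_legs := fun i => by
        have := f.leg_legs (f.legs.symm (e.symm i))
        simpa using this
      genus_vert := f.genus_vert }
  exact (hσ.iso_iff _ _ F rfl Γ₀ Γ₀ hf.2 D).1 h

theorem exists_numbering (c : Fin n → Fin p) (col : L → Fin p)
    (hcol : ∀ k, Nat.card {l // col l = k} = Nat.card {i // c i = k}) :
    ∃ e : L ≃ Fin n, ∀ l, c (e l) = col l := by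
  refine ⟨(Equiv.sigmaFiberEquiv col).symm.trans ((Equiv.sigmaCongrRight fun k =>
    (Finite.card_eq.1 (hcol k)).some).trans (Equiv.sigmaFiberEquiv c)), fun l => ?_⟩
  exact ((Finite.card_eq.1 (hcol (col l))).some ⟨l, rfl⟩).2

theorem bijOn_colouredMultidegrees {d : ℤ} {σ : Set (StableTriple g n)}
    (hσ : IsPaganiTommasi g n d σ) {c : Fin n → Fin p}
    (hinv : IsLabelInvariant (youngSubgroup c) σ) {col : L → Fin p}
    (hcol : ∀ k, Nat.card {l // col l = k} = Nat.card {i // c i = k})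
    (Γ₀ : Γ.ConnectedSubgraph) :
    Set.BijOn (fun D : Γ.V → ℤ => (QuotientAddGroup.mk D : Γ₀.Pic))
      (colouredMultidegrees σ c Γ col Γ₀) (Γ₀.PicOfDegree (d - Γ₀.missingEdges)) := by
  obtain ⟨e, he⟩ := exists_numbering c col hcol
  have h := hσ.representatives (Γ.relabel e) Γ₀
  have : colouredMultidegrees σ c Γ col Γ₀ = {D | ⟨Γ.relabel e, Γ₀, D⟩ ∈ σ} :=
    Set.ext fun D => mem_colouredMultidegrees_iff hinv Γ col Γ₀ D e he
  rw [this]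
  exact h

/-- A multidegree whose class is invariant under an automorphism is invariant if it belongs to a
stability condition. -/
theorem comp_eq_of_sub_mem_twist {d : ℤ} {σ : Set (StableTriple g n)}
    (hσ : IsPaganiTommasi g n d σ) {c : Fin n → Fin p}
    (hinv : IsLabelInvariant (youngSubgroup c) σ) {col : L → Fin p}
    (hcol : ∀ k, Nat.card {l // col l = k} = Nat.card {i // c i = k})
    {Γ₀ : Γ.ConnectedSubgraph} {f : StableGraphIso Γ Γ} (hf : IsColouredAut col Γ₀ f)
    {D : Γ.V → ℤ} (hD : D ∈ colouredMultidegrees σ c Γ col Γ₀)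
    (h : D ∘ f.vert - D ∈ Γ₀.twist) : D ∘ f.vert = D := by
  refine (bijOn_colouredMultidegrees hσ hinv hcol Γ₀).injOn
    (comp_mem_colouredMultidegrees hσ c hf hD) hD ?_
  rw [← sub_eq_zero]
  exact (QuotientAddGroup.eq_zero_iff _).2 h

end Iso

/-- The whole graph as a subgraph. -/
abbrev StableGraph.full {g : ℕ} {L : Type} [Fintype L] (Γ : StableGraph g L) :
    Γ.ConnectedSubgraph where
  halfEdges := Finset.univ
  flip_mem _ _ := Finset.mem_univ _
  connected := Γ.connected

theorem StableGraph.missingEdges_full {g : ℕ} {L : Type} [Fintype L] (Γ : StableGraph g L) :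
    Γ.full.missingEdges = 0 := by
  have := Γ.full.edgeCount_univ
  simpa [StableGraph.full] using this

/-- A set of legs on which the cyclic group of order `m` acts freely, with `m * q k` legs of each
label `k`. -/
abbrev CyclicLegs (m : ℕ) {p : ℕ} (q : Fin p → ℕ) : Type := ZMod m × Σ k, Fin (q k)

theorem card_cyclicLegs_fibre (m : ℕ) {p : ℕ} (q : Fin p → ℕ) (k : Fin p) :
    Nat.card {l : CyclicLegs m q // l.2.1 = k} = m * q k := by
  let e : {l : CyclicLegs m q // l.2.1 = k} ≃ ZMod m × Fin (q k) :=
    Equiv.trans (β := ZMod m × {t : Σ k, Fin (q k) // t.1 = k})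
      ⟨fun l => (l.1.1, ⟨l.1.2, l.2⟩), fun x => ⟨(x.1, x.2.1), x.2.2⟩, fun _ => rfl, fun _ => rfl⟩
      (Equiv.prodCongr (Equiv.refl _) (Equiv.sigmaSubtype k))
  rw [Nat.card_congr e]
  simp [Nat.card_prod, Nat.card_zmod]

/-! ### The cycle of m equal vertices -/

section Cycle

variable (m g₁ : ℕ) [NeZero m]

/-- The cycle with `m` vertices, all of genus `g₁`. -/
abbrev cycleGraph : HalfEdgeGraph where
  V := ZMod m
  H := ZMod m × Bool
  root h := if h.2 then h.1 + 1 else h.1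
  flip h := (h.1, !h.2)
  flip_flip h := by simp
  flip_ne h := by simp [Prod.ext_iff]
  genus _ := g₁

theorem cycleGraph_connected (v w : ZMod m) :
    Relation.ReflTransGen ((cycleGraph m g₁).Step Finset.univ) v w := by
  have key : ∀ k : ℕ, Relation.ReflTransGen ((cycleGraph m g₁).Step Finset.univ) v
      (v + (k : ZMod m)) := by
    intro k
    induction k with
    | zero => simpa using Relation.ReflTransGen.refl
    | succ k ih =>
      refine ih.tail ⟨(v + k, false), Finset.mem_univ _, ?_, ?_⟩
      · simp [cycleGraph]
      · simp [cycleGraph, add_assoc]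
  simpa using key (w - v).val

theorem cycleGraph_filter_root (v : ZMod m)
    [DecidablePred fun h => (cycleGraph m g₁).root h = v] :
    (Finset.univ.filter fun h => (cycleGraph m g₁).root h = v) = {(v, false), (v - 1, true)} := by
  ext ⟨i, b⟩
  cases b <;> simp [eq_sub_iff_add_eq]

theorem card_filter_cyclicLegs {p : ℕ} (q : Fin p → ℕ) (v : ZMod m)
    [DecidablePred fun l : CyclicLegs m q => l.1 = v] :
    (Finset.univ.filter fun l : CyclicLegs m q => l.1 = v).card = ∑ k, q k := by
  have : (Finset.univ.filter fun l : CyclicLegs m q => l.1 = v) =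
      ({v} : Finset (ZMod m)) ×ˢ (Finset.univ : Finset (Σ k, Fin (q k))) := by
    ext ⟨i, t⟩
    simp only [Finset.mem_filter, Finset.mem_univ, true_and, Finset.mem_product,
      Finset.mem_singleton, and_true]
  rw [this, Finset.card_product]
  simp

/-- The stable graph that consists of a cycle with a free rotation-invariant set of legs. -/
abbrev stableCycle {p : ℕ} (q : Fin p → ℕ) (hs : 0 < g₁ ∨ 0 < ∑ k, q k) :
    StableGraph (m * g₁ + 1) (CyclicLegs m q) where
  toHalfEdgeGraph := cycleGraph m g₁
  leg l := l.1
  nonempty := ⟨(0 : ZMod m)⟩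
  connected := cycleGraph_connected m g₁
  stable v := by
    refine lt_of_lt_of_eq (b := 2 * g₁ + 2 + ∑ k, q k) (by omega)
      (congrArg₂ (· + ·) (congrArg₂ (· + ·) rfl ?_) ?_)
    · convert ((congrArg Finset.card (cycleGraph_filter_root m g₁ v)).trans
        (Finset.card_pair (by simp))).symm
    · convert (card_filter_cyclicLegs m q v).symm
  genus_eq := by
    have h1 := (cycleGraph m g₁).two_mul_edgeCount Finset.univ (by simp)
    have h2 : (Finset.univ : Finset (cycleGraph m g₁).H).card = m * 2 := by
      change (Finset.univ : Finset (ZMod m × Bool)).card = m * 2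
      simp [ZMod.card]
    have h3 : Fintype.card (cycleGraph m g₁).V = m := ZMod.card m
    have h4 : ∑ v : (cycleGraph m g₁).V, (cycleGraph m g₁).genus v = m * g₁ := by
      simp [h3]
    rw [h3, h4]
    omega

variable {m g₁} {p : ℕ} {q : Fin p → ℕ} (hs : 0 < g₁ ∨ 0 < ∑ k, q k)

/-- The rotation of the cycle. -/
abbrev cycleRotation : StableGraphIso (stableCycle m g₁ q hs) (stableCycle m g₁ q hs) where
  vert := Equiv.addRight (1 : ZMod m)
  half := Equiv.prodCongr (Equiv.addRight (1 : ZMod m)) (Equiv.refl Bool)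
  legs := Equiv.prodCongr (Equiv.addRight (1 : ZMod m)) (Equiv.refl _)
  root_half := by
    rintro ⟨i, b⟩
    cases b <;> simp [stableCycle, cycleGraph]
  flip_half := by
    rintro ⟨i, b⟩
    cases b <;> simp [stableCycle, cycleGraph]
  leg_legs _ := rfl
  genus_vert _ := rfl

theorem cycleRotation_isColouredAut :
    IsColouredAut (fun l : CyclicLegs m q => l.2.1) (stableCycle m g₁ q hs).full
      (cycleRotation hs) :=
  ⟨fun _ => rfl, fun h => by simp⟩

theorem cycle_twistAt (v : ZMod m) :
    (stableCycle m g₁ q hs).full.twistAt v =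
      ((Pi.single (v + 1) 1 - Pi.single v 1 + (Pi.single (v - 1) 1 - Pi.single v 1)) :
        ZMod m → ℤ) := by
  classical
  have h1 := cycleGraph_filter_root m g₁ v
  unfold HalfEdgeGraph.ConnectedSubgraph.twistAt
  rw [Finset.filter_congr_decidable] at h1
  simp only [h1]
  refine (Finset.sum_pair (by simp)).trans ?_
  simp only [Bool.not_false, Bool.not_true, if_true, Bool.false_eq_true, if_false]
  congr!

/-- The class of `∑ i, D i * i` modulo `m`. -/
def moment (m : ℕ) [NeZero m] : (ZMod m → ℤ) →+ ZMod m where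
  toFun D := ∑ v, (D v : ZMod m) * v
  map_zero' := by simp
  map_add' D E := by simp [add_mul, Finset.sum_add_distrib]

theorem moment_single (v : ZMod m) : moment m (Pi.single v 1) = v := by
  change ∑ w, ((Pi.single v 1 : ZMod m → ℤ) w : ZMod m) * w = v
  rw [Finset.sum_eq_single v]
  · simp
  · intro w _ hw
    simp [hw]
  · simp

theorem moment_twist {D : ZMod m → ℤ} (hD : D ∈ (stableCycle m g₁ q hs).full.twist) :
    moment m D = 0 := by
  classical
  have : (stableCycle m g₁ q hs).full.twist ≤ (moment m).ker := by
    refine (AddSubgroup.closure_le _).2 ?_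
    rintro _ ⟨v, rfl⟩
    change moment m _ = 0
    have h := cycle_twistAt hs v
    rw [h]
    simp only [map_add, map_sub, moment_single]
    ring
  exact this hD

/-- The hypothesis makes δ an arithmetic progression around the cycle; closing up shows that m kills
its common difference. Shifting D changes the sum by the total degree times that difference, which
is zero. -/
theorem sum_shift_smul_eq {A : Type*} [AddCommGroup A] (δ : ZMod m → A)
    (hδ : ∀ v, δ (v + 1) - δ v = δ v - δ (v - 1)) {D : ZMod m → ℤ} (hD : (m : ℤ) ∣ ∑ v, D v) :
    ∑ v, D (v + 1) • δ v = ∑ v, D v • δ v := by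
  have hconst : ∀ k : ℕ, δ ((k : ZMod m) + 1) - δ k = δ 1 - δ 0 := by
    intro k
    induction k with
    | zero => simp
    | succ k ih =>
      rw [← ih, hδ]
      simp
  have hc : ∀ v, δ (v + 1) = δ v + (δ 1 - δ 0) := by
    intro v
    have := hconst v.val
    rw [ZMod.natCast_zmod_val] at this
    rw [← this]
    abel
  have hm : (m : ℤ) • (δ 1 - δ 0) = 0 := by
    have h1 : ∑ v, δ (v + 1) = ∑ v, δ v := Equiv.sum_comp (Equiv.addRight (1 : ZMod m)) δ
    simp only [hc, Finset.sum_add_distrib, Finset.sum_const, Finset.card_univ, ZMod.card] at h1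
    simpa using h1
  have h1 : ∑ v, D (v + 1) • δ (v + 1) = ∑ v, D v • δ v :=
    Equiv.sum_comp (Equiv.addRight (1 : ZMod m)) fun v => D v • δ v
  simp only [hc, smul_add, Finset.sum_add_distrib, ← Finset.sum_smul] at h1
  have h2 : ∑ v, D (v + 1) = ∑ v, D v := Equiv.sum_comp (Equiv.addRight (1 : ZMod m)) D
  obtain ⟨k, hk⟩ := hD
  rwa [h2, hk, mul_comm, mul_smul, hm, smul_zero, add_zero] at h1

/-- The twist relations say that the classes of successive vertices form an arithmetic progression,
so a rotation fixes every class of degree divisible by m. -/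
theorem cycle_comp_sub_mem_twist {D : ZMod m → ℤ} (hD : (m : ℤ) ∣ ∑ v, D v) :
    ((fun v => D (v + 1)) - D : ZMod m → ℤ) ∈ (stableCycle m g₁ q hs).full.twist := by
  classical
  let Q := (stableCycle m g₁ q hs).full.Pic
  let δ : ZMod m → Q := fun v => QuotientAddGroup.mk (Pi.single v 1 : ZMod m → ℤ)
  have hδ : ∀ v, δ (v + 1) - δ v = δ v - δ (v - 1) := by
    intro v
    have h1 : (QuotientAddGroup.mk ((stableCycle m g₁ q hs).full.twistAt v) : Q) = 0 :=
      (QuotientAddGroup.eq_zero_iff _).2 (AddSubgroup.subset_closure ⟨v, rfl⟩)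
    rw [cycle_twistAt] at h1
    have h2 : δ (v + 1) - δ v + (δ (v - 1) - δ v) = 0 := by
      rw [← h1]
      simp only [δ]
      congr!
    rw [← sub_eq_zero, ← h2]
    abel
  have hmk : ∀ E : ZMod m → ℤ, (QuotientAddGroup.mk E : Q) = ∑ v, E v • δ v := by
    intro E
    exact (stableCycle m g₁ q hs).full.mk_eq_sum E
  refine (QuotientAddGroup.eq_zero_iff _).1 ?_
  have h4 : (QuotientAddGroup.mk (fun v => D (v + 1)) : Q) = QuotientAddGroup.mk D := by
    rw [hmk, hmk]
    exact sum_shift_smul_eq δ hδ hD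
  exact sub_eq_zero.2 h4

/-- A rotation-invariant family of stability conditions on a cycle has degree prime to the length
of the cycle. -/

theorem not_dvd_degree (hs : 0 < g₁ ∨ 0 < ∑ k, q k) {n : ℕ} {d : ℤ}
    (hm : 2 ≤ m) {σ : Set (StableTriple (m * g₁ + 1) n)}
    (hσ : IsPaganiTommasi (m * g₁ + 1) n d σ) {c : Fin n → Fin p}
    (hinv : IsLabelInvariant (youngSubgroup c) σ)
    (hq : ∀ k, Nat.card {i // c i = k} = m * q k) : ¬ (m : ℤ) ∣ d := by
  intro hd
  let col : CyclicLegs m q → Fin p := fun l => l.2.1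
  have hcol : ∀ k, Nat.card {l // col l = k} = Nat.card {i // c i = k} := fun k =>
    (card_cyclicLegs_fibre m q k).trans (hq k).symm
  let Γ := stableCycle m g₁ q hs
  have hbij := bijOn_colouredMultidegrees (Γ := Γ) hσ hinv hcol Γ.full
  rw [Γ.missingEdges_full, Nat.cast_zero, sub_zero] at hbij
  -- If m divides d, every class of degree d is rotation-invariant, so every member of σ on the
  -- cycle is constant. There is thus at most one.
  have hconst : ∀ D : ZMod m → ℤ, D ∈ colouredMultidegrees σ c Γ col Γ.full →
      ∑ v, D v = d ∧ ∀ v, D v = D 0 := by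
    intro D hD
    have hdeg : ∑ v, D v = d := hbij.mapsTo hD
    have h := comp_eq_of_sub_mem_twist hσ hinv hcol (cycleRotation_isColouredAut hs) hD
      (cycle_comp_sub_mem_twist hs (hdeg ▸ hd))
    refine ⟨hdeg, fun v => ?_⟩
    have key : ∀ k : ℕ, D k = D 0 := by
      intro k
      induction k with
      | zero => simp
      | succ k ih =>
        rw [← ih, Nat.cast_succ]
        exact congrFun h (k : ZMod m)
    simpa using key v.val
  have hlift : ∀ E : ZMod m → ℤ, ∑ v, E v = d →
      ∃ D ∈ colouredMultidegrees σ c Γ col Γ.full,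
        (QuotientAddGroup.mk D : Γ.full.Pic) = QuotientAddGroup.mk E :=
    fun E hE => hbij.surjOn (show _ = d from hE)
  -- Two multidegrees of degree d whose moments differ by 1, hence in different classes: they need
  -- two distinct members of σ.
  obtain ⟨D₁, hD₁, h₁⟩ := hlift (Pi.single (0 : ZMod m) d) (by simp)
  obtain ⟨D₂, hD₂, h₂⟩ := hlift (Pi.single (0 : ZMod m) (d - 1) + Pi.single (1 : ZMod m) 1) (by
    simp [Finset.sum_add_distrib])
  have hD : D₁ = D₂ := by
    obtain ⟨s₁, c₁⟩ := hconst D₁ hD₁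
    obtain ⟨s₂, c₂⟩ := hconst D₂ hD₂
    have h0 : ∑ v : ZMod m, D₁ 0 = ∑ v : ZMod m, D₂ 0 := by
      rw [← Finset.sum_congr rfl fun v _ => c₁ v, ← Finset.sum_congr rfl fun v _ => c₂ v, s₁, s₂]
    simp only [Finset.sum_const, Finset.card_univ, ZMod.card, nsmul_eq_mul] at h0
    have h1 := mul_left_cancel₀ (Nat.cast_ne_zero.2 (NeZero.ne m)) h0
    exact funext fun v => (c₁ v).trans (h1.trans (c₂ v).symm)
  rw [← hD, h₁] at h₂
  have h3 := moment_twist hs ((QuotientAddGroup.eq).1 h₂)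
  have h4 : ((-Pi.single 0 d + (Pi.single 0 (d - 1) + Pi.single 1 1)) : ZMod m → ℤ) =
      Pi.single 1 1 - Pi.single 0 1 := by
    rw [Pi.single_sub]
    abel
  have h5 : moment m (-Pi.single 0 d + (Pi.single 0 (d - 1) + Pi.single 1 1)) = 0 := h3
  rw [h4, map_sub, moment_single, moment_single, sub_zero] at h5
  have : Fact (1 < m) := ⟨hm⟩
  exact one_ne_zero h5

end Cycle

/-! ### Two equal vertices joined by an edge -/

section Dumbbell

variable (g₁ : ℕ)

/-- Two vertices of genus `g₁` joined by an edge. -/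
abbrev dumbbellGraph : HalfEdgeGraph where
  V := ZMod 2
  H := ZMod 2
  root h := h
  flip h := h + 1
  flip_flip := by decide
  flip_ne := by decide
  genus _ := g₁

theorem dumbbellGraph_connected (v w : ZMod 2) :
    Relation.ReflTransGen ((dumbbellGraph g₁).Step Finset.univ) v w := by
  have h : w = v ∨ w = v + 1 := by revert v w; decide
  rcases h with rfl | rfl
  · exact Relation.ReflTransGen.refl
  · exact Relation.ReflTransGen.single ⟨v, Finset.mem_univ _, rfl, rfl⟩

/-- Two vertices of genus `g₁` joined by an edge, with a symmetric set of legs. -/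
abbrev stableDumbbell {p : ℕ} (q : Fin p → ℕ) (hs : 0 < g₁ ∨ 1 < ∑ k, q k) :
    StableGraph (2 * g₁) (CyclicLegs 2 q) where
  toHalfEdgeGraph := dumbbellGraph g₁
  leg l := l.1
  nonempty := ⟨(0 : ZMod 2)⟩
  connected := dumbbellGraph_connected g₁
  stable v := by
    refine lt_of_lt_of_eq (b := 2 * g₁ + 1 + ∑ k, q k) (by omega)
      (congrArg₂ (· + ·) (congrArg₂ (· + ·) rfl ?_) ?_)
    · symm
      rw [Finset.card_eq_one]
      exact ⟨v, by ext; simp⟩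
    · convert (card_filter_cyclicLegs 2 q v).symm
  genus_eq := by
    have h1 := (dumbbellGraph g₁).two_mul_edgeCount Finset.univ (by simp)
    have h2 : (Finset.univ : Finset (dumbbellGraph g₁).H).card = 2 := ZMod.card 2
    have h3 : Fintype.card (dumbbellGraph g₁).V = 2 := ZMod.card 2
    have h4 : ∑ v : (dumbbellGraph g₁).V, (dumbbellGraph g₁).genus v = 2 * g₁ := by
      simp
    rw [h3, h4]
    omega

variable {g₁} {p : ℕ} {q : Fin p → ℕ} (hs : 0 < g₁ ∨ 1 < ∑ k, q k)

/-- The automorphism that interchanges the two vertices. -/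
abbrev dumbbellSwap : StableGraphIso (stableDumbbell g₁ q hs) (stableDumbbell g₁ q hs) where
  vert := Equiv.addRight (1 : ZMod 2)
  half := Equiv.addRight (1 : ZMod 2)
  legs := Equiv.prodCongr (Equiv.addRight (1 : ZMod 2)) (Equiv.refl _)
  root_half _ := rfl
  flip_half _ := rfl
  leg_legs _ := rfl
  genus_vert _ := rfl

/-- The graph is a tree: twisting at vertex 0 moves one unit across the edge, and multiples of this
give every multidegree of degree 0. -/
theorem dumbbell_mem_twist {D : ZMod 2 → ℤ} (hD : ∑ v, D v = 0) :
    D ∈ (stableDumbbell g₁ q hs).full.twist := by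
  classical
  have h0 : (stableDumbbell g₁ q hs).full.twistAt (0 : ZMod 2) =
      (Pi.single 1 1 - Pi.single 0 1 : ZMod 2 → ℤ) := by
    unfold HalfEdgeGraph.ConnectedSubgraph.twistAt
    refine (Finset.sum_eq_single (0 : ZMod 2) ?_ ?_).trans ?_
    · intro b hb hb'
      exact absurd (by simpa using hb) hb'
    · intro h
      simp at h
    · simp only [zero_add]
      congr!
  have h1 : D 0 + D 1 = 0 := (Fin.sum_univ_two (M := ℤ) D).symm.trans hD
  have h2 : D = D 1 • (Pi.single 1 1 - Pi.single 0 1 : ZMod 2 → ℤ) := by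
    have h3 : ∀ v : ZMod 2, v = 0 ∨ v = 1 := by decide
    ext v
    rcases h3 v with rfl | rfl
    · simp; omega
    · simp
  rw [h2, ← h0]
  exact AddSubgroup.zsmul_mem _ (AddSubgroup.subset_closure (Set.mem_range_self
    (f := (stableDumbbell g₁ q hs).full.twistAt) (0 : ZMod 2))) _

/-- A symmetric family of stability conditions on a graph with two vertices and one edge has even
degree. -/
theorem two_dvd_degree (hs : 0 < g₁ ∨ 1 < ∑ k, q k) {n : ℕ} {d : ℤ}
    {σ : Set (StableTriple (2 * g₁) n)}
    (hσ : IsPaganiTommasi (2 * g₁) n d σ) {c : Fin n → Fin p}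
    (hinv : IsLabelInvariant (youngSubgroup c) σ)
    (hq : ∀ k, Nat.card {i // c i = k} = 2 * q k) : 2 ∣ d := by
  let col : CyclicLegs 2 q → Fin p := fun l => l.2.1
  have hcol : ∀ k, Nat.card {l // col l = k} = Nat.card {i // c i = k} := fun k =>
    (card_cyclicLegs_fibre 2 q k).trans (hq k).symm
  let Γ := stableDumbbell g₁ q hs
  have hbij := bijOn_colouredMultidegrees (Γ := Γ) hσ hinv hcol Γ.full
  rw [Γ.missingEdges_full, Nat.cast_zero, sub_zero] at hbij
  obtain ⟨D, hD, -⟩ : ∃ D ∈ colouredMultidegrees σ c Γ col Γ.full,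
      (QuotientAddGroup.mk D : Γ.full.Pic) =
        QuotientAddGroup.mk (Pi.single (0 : ZMod 2) d : ZMod 2 → ℤ) :=
    hbij.surjOn (show ∑ v : ZMod 2, (Pi.single (0 : ZMod 2) d : ZMod 2 → ℤ) v = d by simp)
  have hdeg : ∑ v : ZMod 2, D v = d := hbij.mapsTo hD
  have hf : IsColouredAut col Γ.full (dumbbellSwap hs) := ⟨fun _ => rfl, fun h => by simp [Γ]⟩
  -- There is only one class of degree d, so the swap fixes it and D takes equal values at the two
  -- vertices.
  have h := comp_eq_of_sub_mem_twist hσ hinv hcol hf hD (dumbbell_mem_twist hs (by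
    have : ∑ v : ZMod 2, D (v + 1) = ∑ v : ZMod 2, D v :=
      Equiv.sum_comp (Equiv.addRight (1 : ZMod 2)) D
    simpa [Finset.sum_sub_distrib, sub_eq_zero] using this))
  have h01 : D (1 : ZMod 2) = D (0 : ZMod 2) := congrFun h (0 : ZMod 2)
  have h1 : D (0 : ZMod 2) + D (1 : ZMod 2) = d := by
    rw [← hdeg]
    exact (Fin.sum_univ_two (M := ℤ) D).symm
  exact ⟨D (0 : ZMod 2), by omega⟩

end Dumbbell

/-! ### Numerical restrictions on the degree -/

/-- Summing the stability inequalities over all vertices and inserting the genus formula gives 2g -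
2 + n ≥ |V| > 0. This makes the test graphs above stable. -/
theorem StableGraph.two_lt {g : ℕ} {L : Type} [Fintype L] (Γ : StableGraph g L) :
    2 < 2 * g + Fintype.card L := by
  classical
  have hV : 0 < Fintype.card Γ.V := Fintype.card_pos_iff.2 Γ.nonempty
  have h1 := Finset.sum_le_sum fun (v : Γ.V) (_ : v ∈ Finset.univ) => Nat.succ_le_of_lt (Γ.stable v)
  simp only [Nat.succ_eq_add_one, Finset.sum_add_distrib, ← Finset.mul_sum, Finset.sum_const,
    Finset.card_univ, smul_eq_mul] at h1
  have h2 : ∑ v, (Finset.univ.filter fun h => Γ.root h = v).card = Fintype.card Γ.H :=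
    (Finset.card_eq_sum_card_fiberwise fun _ _ => Finset.mem_univ _).symm
  have h3 : ∑ v, (Finset.univ.filter fun l => Γ.leg l = v).card = Fintype.card L :=
    (Finset.card_eq_sum_card_fiberwise fun _ _ => Finset.mem_univ _).symm
  have h4 := Γ.two_mul_edgeCount Finset.univ (by simp)
  have h5 := Γ.genus_eq
  rw [Finset.card_univ] at h4
  have h6 : ∑ v, (Finset.univ.filter fun h => Γ.root h = v).card +
      ∑ v, (Finset.univ.filter fun l => Γ.leg l = v).card =
      Fintype.card Γ.H + Fintype.card L := by rw [h2, h3]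
  have h7 : Fintype.card Γ.V * 3 ≤ 2 * ∑ v, Γ.genus v + (Fintype.card Γ.H + Fintype.card L) := by
    rw [← h6]
    refine le_of_eq_of_le (by ring) (h1.trans_eq ?_)
    rw [← add_assoc]
  omega

section Obstruction

variable {g n p : ℕ} {d : ℤ} {σ : Set (StableTriple g n)} (hσ : IsPaganiTommasi g n d σ)
  {c : Fin n → Fin p} (hinv : IsLabelInvariant (youngSubgroup c) σ) (hg : 2 < 2 * g + n)

theorem sum_card_fibre (c : Fin n → Fin p) : ∑ k, Nat.card {i // c i = k} = n := by
  rw [← Nat.card_sigma, Nat.card_congr (Equiv.sigmaFiberEquiv c), Nat.card_fin]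

include hσ hinv hg

/-- If `m` divides `g - 1` and the number of legs of each label, it does not divide the degree of
an invariant stability condition. -/
theorem not_dvd_degree_of_dvd {m : ℕ} (hm : 2 ≤ m) (hmg : (m : ℤ) ∣ g - 1)
    (hc : ∀ k, m ∣ Nat.card {i // c i = k}) : ¬ (m : ℤ) ∣ d := by
  have : NeZero m := ⟨by omega⟩
  choose q hq using hc
  obtain ⟨x, hx⟩ := hmg
  have hx0 : 0 ≤ x := by
    by_contra hneg
    have : (m : ℤ) * x ≤ m * (-1) := mul_le_mul_of_nonneg_left (by omega) (by omega)
    omega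
  obtain ⟨g₁, rfl⟩ := Int.eq_ofNat_of_zero_le hx0
  obtain rfl : g = m * g₁ + 1 := by
    have : (g : ℤ) = ((m * g₁ + 1 : ℕ) : ℤ) := by push_cast; linarith
    exact_mod_cast this
  refine not_dvd_degree ?_ hm hσ hinv hq
  have hn := sum_card_fibre c
  simp only [hq, ← Finset.mul_sum] at hn
  -- For g₁ = 0 the genus is 1, and stability of the type forces at least one leg.
  rcases Nat.eq_zero_or_pos g₁ with rfl | h
  · right
    rw [← hn, mul_zero] at hg
    exact Nat.pos_of_ne_zero fun h0 => by simp [h0] at hg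
  · exact Or.inl h

/-- If `g` and the number of legs of each label are even, so is the degree of an invariant
stability condition. -/
theorem two_dvd_degree_of_dvd (hg2 : 2 ∣ g) (hc : ∀ k, 2 ∣ Nat.card {i // c i = k}) : 2 ∣ d := by
  choose q hq using hc
  obtain ⟨g₁, rfl⟩ := hg2
  refine two_dvd_degree ?_ hσ hinv hq
  have hn := sum_card_fibre c
  simp only [hq, ← Finset.mul_sum] at hn
  omega

end Obstruction

/-! ### Counting the multidegrees fixed by a subgroup -/

section Fixed

variable {g n p : ℕ} {L : Type} [Fintype L] {Γ : StableGraph g L} {c : Fin n → Fin p}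
  {col : L → Fin p} {Γ₀ : Γ.ConnectedSubgraph} {H : Subgroup (Equiv.Perm Γ.V)}

theorem card_vert_mem_invariantDegrees : (Fintype.card Γ.V : ℤ) ∈ Γ.invariantDegrees H :=
  HalfEdgeGraph.card_mem_invariantDegrees Finset.univ id fun a _ => ⟨a, by simp, fun _ => rfl⟩

theorem genus_mem_invariantDegrees (hH : H ≤ vertexAutGroup col Γ₀) :
    ((∑ v, Γ.genus v : ℕ) : ℤ) ∈ Γ.invariantDegrees H := by
  push_cast
  refine HalfEdgeGraph.sum_mem_invariantDegrees fun a ha v => ?_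
  obtain ⟨f, -, rfl⟩ := hH ha
  rw [f.genus_vert]

theorem two_mul_edges_mem_invariantDegrees (hH : H ≤ vertexAutGroup col Γ₀) :
    2 * (Γ.edgeCount Finset.univ : ℤ) ∈ Γ.invariantDegrees H := by
  have h := Γ.two_mul_edgeCount Finset.univ (by simp)
  have h2 := HalfEdgeGraph.card_mem_invariantDegrees (H := H) Finset.univ Γ.root fun a ha => by
    obtain ⟨f, -, rfl⟩ := hH ha
    exact ⟨f.half, by simp, f.root_half⟩
  rw [← h] at h2
  exact_mod_cast h2

theorem two_mul_subgraphEdges_mem_invariantDegrees (hH : H ≤ vertexAutGroup col Γ₀) :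
    2 * (Γ.edgeCount Γ₀.halfEdges : ℤ) ∈ Γ.invariantDegrees H := by
  have h := Γ.two_mul_edgeCount _ Γ₀.flip_mem
  have h2 := HalfEdgeGraph.card_mem_invariantDegrees (H := H) Γ₀.halfEdges Γ.root fun a ha => by
    obtain ⟨f, hf, rfl⟩ := hH ha
    exact ⟨f.half, fun h => (hf.2 h).symm, f.root_half⟩
  rw [← h] at h2
  exact_mod_cast h2

theorem legs_mem_invariantDegrees (hH : H ≤ vertexAutGroup col Γ₀) (k : Fin p) :
    (Nat.card {l // col l = k} : ℤ) ∈ Γ.invariantDegrees H := by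
  classical
  have h2 := HalfEdgeGraph.card_mem_invariantDegrees (H := H)
    (Finset.univ.filter fun l => col l = k) Γ.leg fun a ha => by
      obtain ⟨f, hf, rfl⟩ := hH ha
      exact ⟨f.legs, fun l => by simp [hf.1], f.leg_legs⟩
  rwa [Nat.card_eq_fintype_card, Fintype.card_subtype]

variable {d d' : ℤ} {σ σ' : Set (StableTriple g n)} (hσ : IsPaganiTommasi g n d σ)
  (hσ' : IsPaganiTommasi g n d' σ')
  (hinv : IsLabelInvariant (youngSubgroup c) σ) (hinv' : IsLabelInvariant (youngSubgroup c) σ')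
  (hcol : ∀ k, Nat.card {l // col l = k} = Nat.card {i // c i = k})
  (hH : H ≤ vertexAutGroup col Γ₀)

include hcol in
theorem two_lt_of_card_fibre (Γ : StableGraph g L) : 2 < 2 * g + n := by
  obtain ⟨e, -⟩ := exists_numbering c col hcol
  have h := Fintype.card_congr e
  rw [Fintype.card_fin] at h
  exact h ▸ Γ.two_lt

include hσ hinv hcol hH

/-- As q is odd, it divides |E| and |E(Γ₀)| and not merely their doubles. It therefore divides g -
1, every n_k and the number of missing edges, and the cycle of length q applies. -/
theorem not_dvd_of_odd_prime {q : ℕ} (hq : q.Prime) (hq2 : q ≠ 2)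
    (h : ∀ x ∈ Γ.invariantDegrees H, (q : ℤ) ∣ x) : ¬ (q : ℤ) ∣ d - Γ₀.missingEdges := by
  have hcop : IsCoprime (q : ℤ) 2 := by
    have := (Nat.coprime_primes hq Nat.prime_two).2 hq2
    exact_mod_cast Nat.isCoprime_iff_coprime.2 this
  have h1 := h _ card_vert_mem_invariantDegrees
  have h2 := h _ (genus_mem_invariantDegrees hH)
  have h3 := hcop.dvd_of_dvd_mul_left (h _ (two_mul_edges_mem_invariantDegrees hH))
  have h4 := hcop.dvd_of_dvd_mul_left (h _ (two_mul_subgraphEdges_mem_invariantDegrees hH))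
  have h5 := Γ.genus_eq
  have h6 := Γ₀.edgeCount_univ
  have h7 : (q : ℤ) ∣ (g : ℤ) - 1 := by
    have : (g : ℤ) - 1 = (∑ v, Γ.genus v : ℕ) + Γ.edgeCount Finset.univ - Fintype.card Γ.V := by
      omega
    rw [this]
    exact ((h2.add h3).sub h1)
  have h8 := not_dvd_degree_of_dvd hσ hinv (two_lt_of_card_fibre hcol Γ) hq.two_le h7 fun k => by
    rw [← hcol k]
    exact_mod_cast h _ (legs_mem_invariantDegrees hH k)
  intro h9
  apply h8
  have : d = d - Γ₀.missingEdges + (Γ.edgeCount Finset.univ - Γ.edgeCount Γ₀.halfEdges) := by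
    omega
  rw [this]
  exact h9.add (h3.sub h4)

/-- Here g - 1 ≡ |E| modulo 2, while the cycle of length 2 (g odd) and the two-vertex tree (g even)
give d ≡ g. The number in question is congruent to d - |E|, hence odd. -/
theorem odd_of_two_dvd (h : ∀ x ∈ Γ.invariantDegrees H, 2 ∣ x) :
    ¬ 2 ∣ d - Γ₀.missingEdges + Γ.edgeCount Γ₀.halfEdges := by
  have h1 := h _ card_vert_mem_invariantDegrees
  have h2 := h _ (genus_mem_invariantDegrees hH)
  have h5 := Γ.genus_eq
  have h6 := Γ₀.edgeCount_univ
  have h7 : ∀ k, 2 ∣ Nat.card {i // c i = k} := fun k => by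
    rw [← hcol k]
    exact_mod_cast h _ (legs_mem_invariantDegrees hH k)
  have hg := two_lt_of_card_fibre hcol Γ
  have h8 : (2 : ℤ) ∣ g - 1 → ¬ 2 ∣ d := fun h' =>
    not_dvd_degree_of_dvd (m := 2) hσ hinv hg le_rfl (by exact_mod_cast h') h7
  have h9 : 2 ∣ g → 2 ∣ d := fun h' => two_dvd_degree_of_dvd hσ hinv hg h' h7
  omega

include hσ' hinv'

/-- Let a generate the group of invariant degrees. Membership of d - e excludes odd prime factors of
a. If a is even, it is in fact ±2, and d - e and d' - e have the same parity, opposite to that of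
|E(Γ₀)|. -/
theorem mem_invariantDegrees_transfer
    (h : d - Γ₀.missingEdges ∈ Γ.invariantDegrees H) :
    d' - Γ₀.missingEdges ∈ Γ.invariantDegrees H := by
  obtain ⟨a, ha⟩ := Int.subgroup_cyclic (Γ.invariantDegrees H)
  have hmem : ∀ x, x ∈ Γ.invariantDegrees H ↔ a ∣ x := fun x => by
    rw [ha, ← AddSubgroup.zmultiples_eq_closure, Int.mem_zmultiples_iff]
  rw [hmem] at h ⊢
  have hodd : ∀ q : ℕ, q.Prime → (q : ℤ) ∣ a → q = 2 := by
    intro q hq hqa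
    by_contra hq2
    exact not_dvd_of_odd_prime hσ hinv hcol hH hq hq2
      (fun x hx => hqa.trans ((hmem x).1 hx)) (hqa.trans h)
  rcases eq_or_ne a.natAbs 1 with h1 | h1
  · exact (Int.isUnit_iff_natAbs_eq.2 h1).dvd
  obtain ⟨q, hq, hqa⟩ := Nat.exists_prime_and_dvd h1
  have hqa' : (q : ℤ) ∣ a := Int.natCast_dvd.2 hqa
  obtain rfl := hodd q hq hqa'
  obtain ⟨b, rfl⟩ := hqa'
  have h2 : ∀ x ∈ Γ.invariantDegrees H, 2 ∣ x := fun x hx =>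
    (dvd_mul_right _ _).trans ((hmem x).1 hx)
  have hk := odd_of_two_dvd hσ hinv hcol hH h2
  have hk' := odd_of_two_dvd hσ' hinv' hcol hH h2
  -- With a = 2b, the invariant degree 2|E(Γ₀)| gives b ∣ |E(Γ₀)|. As d - e is even, |E(Γ₀)| is odd,
  -- so b has no prime factor at all.
  have hE := (hmem _).1 (two_mul_subgraphEdges_mem_invariantDegrees hH)
  have hbE : b ∣ (Γ.edgeCount Γ₀.halfEdges : ℤ) :=
    (mul_dvd_mul_iff_left (two_ne_zero (α := ℤ))).1 hE
  have hd : 2 ∣ d - Γ₀.missingEdges := (dvd_mul_right _ _).trans h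
  have hb : b.natAbs = 1 := by
    by_contra hb
    obtain ⟨r, hr, hrb⟩ := Nat.exists_prime_and_dvd hb
    have hrb' : (r : ℤ) ∣ b := Int.natCast_dvd.2 hrb
    obtain rfl := hodd r hr (hrb'.trans (dvd_mul_left _ _))
    have : (2 : ℤ) ∣ Γ.edgeCount Γ₀.halfEdges := hrb'.trans hbE
    omega
  have hd' : 2 ∣ d' - Γ₀.missingEdges := by omega
  exact ((Int.isUnit_iff_natAbs_eq.2 hb).mul_right_dvd).2 hd'

omit hσ' hinv'

/-- If D is the member of σ equivalent to E, then D ∘ f is equivalent to E ∘ f = E, hence to D, and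
uniqueness of representatives gives D ∘ f = D. -/
theorem exists_invariant_representative {E : Γ.V → ℤ} (hE : E ∈ Γ.invariantMultidegrees H)
    (hdeg : Γ.degree E = d - Γ₀.missingEdges) :
    ∃ D, (D ∈ colouredMultidegrees σ c Γ col Γ₀ ∧ D ∈ Γ.invariantMultidegrees H) ∧
      (QuotientAddGroup.mk D : Γ₀.Pic) = QuotientAddGroup.mk E := by
  obtain ⟨D, hD, hDE⟩ : ∃ D ∈ colouredMultidegrees σ c Γ col Γ₀,
      (QuotientAddGroup.mk D : Γ₀.Pic) = QuotientAddGroup.mk E :=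
    (bijOn_colouredMultidegrees hσ hinv hcol Γ₀).surjOn (show _ = _ from hdeg)
  refine ⟨D, ⟨hD, fun a ha => ?_⟩, hDE⟩
  obtain ⟨f, hf, rfl⟩ := hH ha
  refine comp_eq_of_sub_mem_twist hσ hinv hcol hf hD ?_
  have h1 : D - E ∈ Γ₀.twist := (QuotientAddGroup.eq_zero_iff _).1 (sub_eq_zero.2 hDE)
  have h2 := comp_mem_twist hf.2 h1
  have h3 : D ∘ f.vert - D = (D - E) ∘ f.vert - (D - E) := by
    have h4 : E ∘ f.vert = E := hE _ ha
    have h5 : (D - E) ∘ f.vert = D ∘ f.vert - E ∘ f.vert := rfl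
    rw [h5, h4]
    abel
  rw [h3]
  exact Γ₀.twist.sub_mem h2 h1

omit hH in
theorem finite_colouredMultidegrees : (colouredMultidegrees σ c Γ col Γ₀).Finite :=
  Set.Finite.of_injOn (bijOn_colouredMultidegrees hσ hinv hcol Γ₀).mapsTo
    (bijOn_colouredMultidegrees hσ hinv hcol Γ₀).injOn (Γ₀.finite_picOfDegree _)

include hσ' hinv'

/-- With D₀ an invariant member of σ and E an invariant multidegree of degree d' - e, translation of
classes by E - D₀ carries invariant members of σ injectively to those of σ'. -/
theorem ncard_invariant_le :
    {D ∈ colouredMultidegrees σ c Γ col Γ₀ | D ∈ Γ.invariantMultidegrees H}.ncard ≤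
      {D ∈ colouredMultidegrees σ' c Γ col Γ₀ | D ∈ Γ.invariantMultidegrees H}.ncard := by
  rcases Set.eq_empty_or_nonempty
    {D ∈ colouredMultidegrees σ c Γ col Γ₀ | D ∈ Γ.invariantMultidegrees H} with he | ⟨D₀, h0, h0'⟩
  · simp [he]
  have hbij := bijOn_colouredMultidegrees hσ hinv hcol Γ₀
  have hdeg : ∀ D ∈ colouredMultidegrees σ c Γ col Γ₀, Γ.degree D = d - Γ₀.missingEdges :=
    fun D hD => hbij.mapsTo hD
  obtain ⟨E, hE, hEd⟩ := mem_invariantDegrees_transfer hσ hσ' hinv hinv' hcol hH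
    ⟨D₀, h0', hdeg D₀ h0⟩
  have hex : ∀ D, ∃ D', D ∈ {D ∈ colouredMultidegrees σ c Γ col Γ₀ |
      D ∈ Γ.invariantMultidegrees H} →
      (D' ∈ colouredMultidegrees σ' c Γ col Γ₀ ∧ D' ∈ Γ.invariantMultidegrees H) ∧
      (QuotientAddGroup.mk D' : Γ₀.Pic) = QuotientAddGroup.mk (D - D₀ + E) := by
    intro D
    by_cases hD : D ∈ {D ∈ colouredMultidegrees σ c Γ col Γ₀ | D ∈ Γ.invariantMultidegrees H}
    · obtain ⟨D', hD'⟩ := exists_invariant_representative hσ' hinv' hcol hH (E := D - D₀ + E)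
        (add_mem (sub_mem hD.2 h0') hE)
        (by rw [map_add, map_sub, hEd, hdeg D hD.1, hdeg D₀ h0, sub_self, zero_add])
      exact ⟨D', fun _ => hD'⟩
    · exact ⟨0, fun h => absurd h hD⟩
  choose F hF using hex
  refine Set.ncard_le_ncard_of_injOn F (fun D hD => (hF D hD).1) (fun D hD D' hD' hDD' => ?_)
    ((finite_colouredMultidegrees hσ' hinv' hcol).subset (Set.sep_subset _ _))
  refine hbij.injOn hD.1 hD'.1 ?_
  have h1 := (hF D hD).2
  rw [hDD', (hF D' hD').2] at h1
  have h2 : (QuotientAddGroup.mk (D' - D₀ + E) : Γ₀.Pic) =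
    QuotientAddGroup.mk D' - QuotientAddGroup.mk D₀ + QuotientAddGroup.mk E := rfl
  have h3 : (QuotientAddGroup.mk (D - D₀ + E) : Γ₀.Pic) =
    QuotientAddGroup.mk D - QuotientAddGroup.mk D₀ + QuotientAddGroup.mk E := rfl
  rw [h2, h3] at h1
  exact (sub_left_injective (add_left_injective _ h1)).symm

theorem ncard_invariant_eq :
    {D ∈ colouredMultidegrees σ c Γ col Γ₀ | D ∈ Γ.invariantMultidegrees H}.ncard =
      {D ∈ colouredMultidegrees σ' c Γ col Γ₀ | D ∈ Γ.invariantMultidegrees H}.ncard :=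
  (ncard_invariant_le hσ hσ' hinv hinv' hcol hH).antisymm
    (ncard_invariant_le hσ' hσ hinv' hinv hcol hH)

end Fixed

end

/-! ### The equivariant bijection -/

theorem mainTheorem3 {g n p : ℕ} {d d' : ℤ} (σ σ' : Set (StableTriple g n))
    (hσ : IsPaganiTommasi g n d σ) (hσ' : IsPaganiTommasi g n d' σ')
    (c : Fin n → Fin p)
    (hinv : IsLabelInvariant (youngSubgroup c) σ)
    (hinv' : IsLabelInvariant (youngSubgroup c) σ')
    {L : Type} [Fintype L] (Γ : StableGraph g L) (col : L → Fin p)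
    (hcol : ∀ k, Nat.card {l // col l = k} = Nat.card {i // c i = k})
    (Γ₀ : Γ.ConnectedSubgraph) :
    (∀ f : StableGraphIso Γ Γ, IsColouredAut col Γ₀ f →
      (∀ D ∈ colouredMultidegrees σ c Γ col Γ₀,
        D ∘ f.vert ∈ colouredMultidegrees σ c Γ col Γ₀) ∧
      (∀ D ∈ colouredMultidegrees σ' c Γ col Γ₀,
        D ∘ f.vert ∈ colouredMultidegrees σ' c Γ col Γ₀)) ∧
    ∃ φ : colouredMultidegrees σ c Γ col Γ₀ ≃ colouredMultidegrees σ' c Γ col Γ₀,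
      ∀ f : StableGraphIso Γ Γ, IsColouredAut col Γ₀ f →
        ∀ D E : colouredMultidegrees σ c Γ col Γ₀, (E : Γ.V → ℤ) = D.1 ∘ f.vert →
          (φ E : Γ.V → ℤ) = (φ D).1 ∘ f.vert := by
  classical
  refine ⟨fun f hf => ⟨fun D hD => comp_mem_colouredMultidegrees hσ c hf hD,
    fun D hD => comp_mem_colouredMultidegrees hσ' c hf hD⟩, ?_⟩
  let G := vertexAutGroup col Γ₀
  -- This left action precomposes with the inverse permutation, so pullback along f is the action of
  -- the inverse of `f.vert`.
  let _ : MulAction G (Γ.V → ℤ) := arrowAction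
  have hsmul : ∀ (a : G) (D : Γ.V → ℤ), a • D = D ∘ (a⁻¹ : G).1 := fun _ _ => rfl
  have hset : ∀ (τ : Set (StableTriple g n)) (H : Subgroup G),
      {D ∈ colouredMultidegrees τ c Γ col Γ₀ | ∀ a ∈ H, a • D = D} =
      {D ∈ colouredMultidegrees τ c Γ col Γ₀ |
        D ∈ Γ.invariantMultidegrees (H.map G.subtype)} := by
    intro τ H
    ext D
    refine and_congr_right fun _ => ⟨?_, fun h a ha => ?_⟩
    · rintro h _ ⟨a, ha, rfl⟩
      have := h a⁻¹ (H.inv_mem ha)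
      rwa [hsmul, inv_inv] at this
    · exact h _ ⟨a⁻¹, H.inv_mem ha, rfl⟩
  have hG : ∀ (τ : Set (StableTriple g n)) (e : ℤ), IsPaganiTommasi g n e τ →
      ∀ (a : G), ∀ D ∈ colouredMultidegrees τ c Γ col Γ₀,
        a • D ∈ colouredMultidegrees τ c Γ col Γ₀ := by
    intro τ e hτ a D hD
    obtain ⟨f, hf, hfa⟩ := (a⁻¹ : G).2
    rw [hsmul, ← hfa]
    exact comp_mem_colouredMultidegrees hτ c hf hD
  obtain ⟨φ, hφ, hφe⟩ := exists_equivariant_bijOn (G := G) _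
    (colouredMultidegrees σ c Γ col Γ₀) (colouredMultidegrees σ' c Γ col Γ₀)
    (finite_colouredMultidegrees hσ hinv hcol)
    (finite_colouredMultidegrees hσ' hinv' hcol) rfl
    (hG σ d hσ) (hG σ' d' hσ') (fun H => by
      rw [hset, hset]
      refine ncard_invariant_eq hσ hσ' hinv hinv' hcol ?_
      rintro _ ⟨a, -, rfl⟩
      exact a.2)
  refine ⟨hφ.equiv φ, fun f hf D E hE => ?_⟩
  let a : G := ⟨f.vert, f, hf, rfl⟩
  have ha : ∀ D : Γ.V → ℤ, a⁻¹ • D = D ∘ f.vert := fun D => by rw [hsmul, inv_inv]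
  change φ E.1 = φ D.1 ∘ f.vert
  rw [hE, ← ha, hφe _ _ D.2, ha]
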